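/- **Conventions.** Let $K$ be a compact line, i.e. a linearly ordered set that is compact in its order topology, with minimum $0_K$ and maximum $1_K$, and assume $0_K<1_K$. The point $1_K$ is *left-dense* if it has no immediate predecessor, and $0_K$ is *right-dense* if it has no immediate successor. A *gauge* $\delta$ on $K$ assigns to each $x\in K$ an interval $\delta(x)\ni x$ that is an open subset of $K$. A *partition* $P$ of $K$ consists of points $0_K=x_0\le x_1\le\dots\le x_n=1_K$ and tags $t_i\in[x_{i-1},x_i]$; it is *$\delta$-fine* if $(x_{i-1},x_i]\subset\delta(t_i)$ for all $i$. For $f,G:K\to\mathbb R$ put $$S(f,G,P)=f(0_K)G(0_K)+\sum_{i=1}^n f(t_i)\bigl(G(x_i)-G(x_{i-1})\bigr).$$ The function $f$ is *$G$-integrable* (on $K$) with integral $\int_K f\,dG=I\in\mathbb R$ if for every $\varepsilon>0$ there is a gauge $\delta$ on $K$ such that $|S(f,G,P)-I|<\varepsilon$ for every $\delta$-fine partition $P$ of $K$. For an interval $J\subset K$ write $f_J=f\chi_J$, where $\chi_J$ is the indicator function of $J$. For $y\in(0_K,1_K)$, $f$ is *$G$-integrable on $[0_K,y]$* if the restriction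 $f|_{[0_K,y]}$ is $G|_{[0_K,y]}$-integrable on the compact line $[0_K,y]$, and the integral is then denoted by $\int_{0_K}^y f\,dG$; $f$ is *$G$-integrable on $(y,1_K]$* if $f_{(y,1_K]}$ is $G$-integrable on $K$. **Theorem (Hake's theorem).** Let $G:K\to\mathbb R$ be nondecreasing and right-continuous, and let $f:K\to\mathbb R$ be any function. 1. Assume that $1_K$ is left-dense, that $f$ is $G$-integrable on $[0_K,y]$ for every $y\in(0_K,1_K)$, and that the limit $$A=\lim_{y\nearrow 1_K}\int_K f_{[0_K,y]}\,dG\in\mathbb R$$ exists. Then, for every $y\in(0_K,1_K)$, $f_{[0_K,y]}$ is $G$-integrable on $K$ and $\int_K f_{[0_K,y]}\,dG=\int_{0_K}^y f\,dG$; moreover, $f$ is $G$-integrable on $K$ and $$\int_K f\,dG=A+f(1_K)\bigl(G(1_K)-L_G(1_K)\bigr),\qquad\text{where } L_G(1_K)=\lim_{y\nearrow 1_K}G(y).$$ 2. Assume that $0_K$ is right-dense, that $f$ is $G$-integrable on $(y,1_K]$ for every $y\in(0_K,1_K)$, and that the limit $$B=\lim_{y\searrow 0_K}\int_K f_{(y,1_K]}\,dG\in\mathbb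 R$$ exists. Then $f$ is $G$-integrable on $K$ and $$\int_K f\,dG=B+f(0_K)\,G(0_K).$$ -/

import Mathlib

open Filter Topology

namespace CompactLine

/-- `x` is left-isolated: it has an immediate predecessor. -/
def LeftIsolated {K : Type*} [LinearOrder K] (x : K) : Prop := ∃ p, p ⋖ x

/-- `x` is right-isolated: it has an immediate successor. -/
def RightIsolated {K : Type*} [LinearOrder K] (x : K) : Prop := ∃ s, x ⋖ s

/-- A point `x > 0_K` is left-dense if it is not left-isolated. -/
def LeftDense {K : Type*} [LinearOrder K] [BoundedOrder K] (x : K) : Prop :=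
  ⊥ < x ∧ ¬ LeftIsolated x

/-- A point `x < 1_K` is right-dense if it is not right-isolated. -/
def RightDense {K : Type*} [LinearOrder K] [BoundedOrder K] (x : K) : Prop :=
  x < ⊤ ∧ ¬ RightIsolated x

/-- Tagged partitions `0_K = x₀ ≤ x₁ ≤ ⋯ ≤ xₙ = 1_K` with tags `tᵢ ∈ [xᵢ₋₁, xᵢ]`.
The `i`-th subinterval is `[x i.castSucc, x i.succ]`, with `i` counted from `0`. -/
structure TaggedPartition (K : Type*) [LinearOrder K] [BoundedOrder K] where
  n : ℕ
  x : Fin (n + 1) → K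
  t : Fin n → K
  x_first : x 0 = ⊥
  x_last : x (Fin.last n) = ⊤
  le_tag : ∀ i : Fin n, x i.castSucc ≤ t i
  tag_le : ∀ i : Fin n, t i ≤ x i.succ

/-- A gauge assigns to each point an open interval containing it; an interval is an
order-convex set, and open is meant in the topological sense. -/
structure Gauge (K : Type*) [LinearOrder K] [TopologicalSpace K] where
  toFun : K → Set K
  isOpen : ∀ x, IsOpen (toFun x)
  ordConnected : ∀ x, (toFun x).OrdConnected
  mem : ∀ x, x ∈ toFun x

/-- `P` is `δ`-fine: `(xᵢ₋₁, xᵢ] ⊆ δ(tᵢ)` for every `i`. -/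
def TaggedPartition.IsFine {K : Type*} [LinearOrder K] [BoundedOrder K] [TopologicalSpace K]
    (P : TaggedPartition K) (δ : Gauge K) : Prop :=
  ∀ i : Fin P.n, Set.Ioc (P.x i.castSucc) (P.x i.succ) ⊆ δ.toFun (P.t i)

/-- `S(f, G, P) = f(0_K) G(0_K) + ∑ᵢ f(tᵢ) (G(xᵢ) - G(xᵢ₋₁))`. -/
def riemannSum {K : Type*} [LinearOrder K] [BoundedOrder K] (f G : K → ℝ)
    (P : TaggedPartition K) : ℝ :=
  f ⊥ * G ⊥ + ∑ i : Fin P.n, f (P.t i) * (G (P.x i.succ) - G (P.x i.castSucc))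

/-- `A` is a value of the `G`-integral of `f` over `K`. -/
def HasGIntegral {K : Type*} [LinearOrder K] [BoundedOrder K] [TopologicalSpace K]
    (f G : K → ℝ) (A : ℝ) : Prop :=
  ∀ ε : ℝ, 0 < ε → ∃ δ : Gauge K, ∀ P : TaggedPartition K, P.IsFine δ →
    |riemannSum f G P - A| < ε

/-- `f` is `G`-integrable over `K`. -/
def GIntegrable {K : Type*} [LinearOrder K] [BoundedOrder K] [TopologicalSpace K]
    (f G : K → ℝ) : Prop :=
  ∃ A : ℝ, HasGIntegral f G A

open Classical in
/-- The `G`-integral `∫_K f dG` (with value `0` if `f` is not `G`-integrable). -/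
noncomputable def gIntegral {K : Type*} [LinearOrder K] [BoundedOrder K] [TopologicalSpace K]
    (f G : K → ℝ) : ℝ :=
  if h : GIntegrable f G then h.choose else 0

open Classical in
/-- `L_G(x)`: it is `0` at `0_K`, the value of `G` at the immediate predecessor if `x` is
left-isolated, and the limit of `G` from the left if `x` is left-dense. -/
noncomputable def leftValue {K : Type*} [LinearOrder K] [BoundedOrder K] [TopologicalSpace K]
    (G : K → ℝ) (x : K) : ℝ :=
  if x = ⊥ then 0
  else if h : LeftIsolated x then G h.choose
  else limUnder (𝓝[<] x) G

end CompactLine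

/-!
Hake's theorem on a compact line says that an improper integral at an end point is already a proper
gauge integral. Given the primitives `F y`, the integrals up to `y < 1_K`, one gauge is needed whose
fine sums over `(0_K, y]` are close to `F y` uniformly in `y` (`exists_uniform_gauge`). Granting
this, a gauge that keeps `1_K` out of the neighbourhoods of all other points makes `1_K` the tag of
the last nondegenerate interval, so a Riemann sum splits into a sum over `(0_K, y]` with `y` close
to `1_K` and the term `f(1_K) (G(1_K) - G(y))`, and both converge (`hasIntegralOn_top_of_tendsto`).
At `0_K` the neighbourhoods of points `x > 0_K` are shrunk to avoid a point of `(0_K, x)`, so the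
first nondegenerate interval has tag `0_K` and contributes little by right-continuity of `G`
(`hasIntegralOn_bot_of_tendsto`).

A uniform gauge is glued from gauges for countably many intervals, with errors forming a geometric
series, by means of Henstock's lemma (`IsFineSum.abs_deviation_le`). A compact line need not have
countable cofinality at its end points, but `G` takes care of this: if `G` is constant near the end
point, the integrals stabilize there, and otherwise points whose `G`-values tend to the one-sided
limit of `G` form a sequence converging to the end point.

Partitions are described by an inductive predicate `IsFineSum` for the values of Riemann sums over
fine chains between two points of `K`. Cousin's lemma (`IsFineSum.exists_of_le`) gives the
existence of fine chains, hence uniqueness of integrals.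
-/

namespace CompactLine

/-! ### Sums over fine chains -/

/-- `IsFineSum δ h u v s` says that `s` is the sum of the weights `h tᵢ xᵢ₋₁ xᵢ` over some
`δ`-fine chain `u = x₀ ≤ t₁ ≤ x₁ ≤ ⋯ ≤ xₙ = v`. Describing partitions of `[u, v]` by appending
one tagged interval at a time lets partitions be compared by induction. Here `δ` is any set-valued
map, and intervals of different partitions all live in the ambient order. -/
inductive IsFineSum {K : Type*} [Preorder K] (δ : K → Set K) (h : K → K → K → ℝ) (u : K) :
    K → ℝ → Prop
  | refl : IsFineSum δ h u u 0
  | step {v : K} {s : ℝ} (t w : K) : IsFineSum δ h u v s → v ≤ t → t ≤ w →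
      Set.Ioc v w ⊆ δ t → IsFineSum δ h u w (s + h t v w)

/-- The weight `f(t) (G(w) - G(v))` of the Riemann sums for `∫ f dG`. -/
def stieltjesWeight {K : Type*} (f G : K → ℝ) (t v w : K) : ℝ := f t * (G w - G v)

theorem stieltjesWeight_self {K : Type*} (f G : K → ℝ) (t v : K) :
    stieltjesWeight f G t v v = 0 := by
  simp [stieltjesWeight]

namespace IsFineSum

variable {K : Type*} [LinearOrder K] {δ δ' : K → Set K} {h : K → K → K → ℝ} {u v w : K} {r s : ℝ}

theorem le (H : IsFineSum δ h u v s) : u ≤ v := by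
  induction H with
  | refl => exact le_rfl
  | step t w _ h1 h2 _ ih => exact ih.trans (h1.trans h2)

theorem trans (H : IsFineSum δ h u v r) (H' : IsFineSum δ h v w s) :
    IsFineSum δ h u w (r + s) := by
  induction H' with
  | refl => simpa using H
  | step t w _ h1 h2 h3 ih => rw [← add_assoc]; exact ih.step t w h1 h2 h3

theorem mono (hδ : ∀ x, δ x ⊆ δ' x) (H : IsFineSum δ h u v s) : IsFineSum δ' h u v s := by
  induction H with
  | refl => exact .refl
  | step t w _ h1 h2 h3 ih => exact ih.step t w h1 h2 (h3.trans (hδ t))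

theorem single (t : K) (h1 : u ≤ t) (h2 : t ≤ v) (h3 : Set.Ioc u v ⊆ δ t) :
    IsFineSum δ h u v (h t u v) := by
  simpa using IsFineSum.refl.step t v h1 h2 h3

theorem eq_zero (h0 : ∀ t v, h t v v = 0) (H : IsFineSum δ h u v s) (huv : u = v) : s = 0 := by
  induction H with
  | refl => rfl
  | @step v s t w H h1 h2 _ ih =>
    have h4 := H.le
    have : v = w := le_antisymm (h1.trans h2) (huv ▸ h4)
    subst this
    rw [ih huv, h0, zero_add]

/-- A sum over a fine chain comes from the points and tags of a partition indexed by `Fin`. -/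
theorem exists_fin (H : IsFineSum δ h u v s) :
    ∃ (n : ℕ) (x : Fin (n + 1) → K) (t : Fin n → K), x 0 = u ∧ x (Fin.last n) = v ∧
      (∀ i : Fin n, x i.castSucc ≤ t i) ∧ (∀ i : Fin n, t i ≤ x i.succ) ∧
      (∀ i : Fin n, Set.Ioc (x i.castSucc) (x i.succ) ⊆ δ (t i)) ∧
      s = ∑ i : Fin n, h (t i) (x i.castSucc) (x i.succ) := by
  induction H with
  | refl => exact ⟨0, fun _ => u, Fin.elim0, rfl, rfl, fun i => i.elim0, fun i => i.elim0,
      fun i => i.elim0, by simp⟩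
  | step t w _ h1 h2 h3 ih =>
    obtain ⟨n, x, τ, hx0, hxn, hl, hr, hf, hs⟩ := ih
    have e1 : ∀ i : Fin n, (Fin.snoc x w : Fin (n + 2) → K) i.castSucc.succ = x i.succ := by
      intro i
      rw [Fin.succ_castSucc]
      exact Fin.snoc_castSucc (α := fun _ => K) w x i.succ
    have e2 : ∀ i : Fin (n + 1), (Fin.snoc x w : Fin (n + 2) → K) i.castSucc = x i :=
      fun i => Fin.snoc_castSucc (α := fun _ => K) w x i
    have e3 : (Fin.snoc x w : Fin (n + 2) → K) (Fin.last n).succ = w := by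
      rw [Fin.succ_last]
      exact Fin.snoc_last (α := fun _ => K) w x
    have e4 : ∀ i : Fin n, (Fin.snoc τ t : Fin (n + 1) → K) i.castSucc = τ i :=
      fun i => Fin.snoc_castSucc (α := fun _ => K) t τ i
    have e5 : (Fin.snoc τ t : Fin (n + 1) → K) (Fin.last n) = t :=
      Fin.snoc_last (α := fun _ => K) t τ
    refine ⟨n + 1, Fin.snoc x w, Fin.snoc τ t, ?_, Fin.snoc_last (α := fun _ => K) w x,
      ?_, ?_, ?_, ?_⟩
    · rw [← Fin.castSucc_zero, e2, hx0]
    · refine Fin.lastCases ?_ fun i => ?_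
      · rw [e2, e5, hxn]; exact h1
      · rw [e2, e4]; exact hl i
    · refine Fin.lastCases ?_ fun i => ?_
      · rw [e3, e5]; exact h2
      · rw [e1, e4]; exact hr i
    · refine Fin.lastCases ?_ fun i => ?_
      · rw [e2, e3, e5, hxn]; exact h3
      · rw [e2, e1, e4]; exact hf i
    · rw [Fin.sum_univ_castSucc, hs]
      simp only [e1, e2, e3, e4, e5, hxn]

/-- Conversely, the points and tags of a partition indexed by `Fin` give a fine chain. -/
theorem of_fin (n : ℕ) (x : Fin (n + 1) → K) (t : Fin n → K)
    (hl : ∀ i : Fin n, x i.castSucc ≤ t i) (hr : ∀ i : Fin n, t i ≤ x i.succ)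
    (hf : ∀ i : Fin n, Set.Ioc (x i.castSucc) (x i.succ) ⊆ δ (t i)) :
    IsFineSum δ h (x 0) (x (Fin.last n)) (∑ i : Fin n, h (t i) (x i.castSucc) (x i.succ)) := by
  induction n with
  | zero => simpa using IsFineSum.refl
  | succ n ih =>
    rw [Fin.sum_univ_castSucc]
    exact (ih (fun i => x i.castSucc) (fun i => t i.castSucc) (fun i => hl i.castSucc)
      (fun i => hr i.castSucc) (fun i => hf i.castSucc)).step (t (Fin.last n))
      (x (Fin.last n).succ) (hl _) (hr _) (hf _)

/-- **Cousin's lemma**: on a compact line every gauge admits a fine chain between any two points.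
The largest point of the closure of the set of reachable points is reachable, and from a reachable
point other than the right end a further one can be reached. -/
theorem exists_of_le [TopologicalSpace K] [OrderTopology K] [CompactSpace K]
    (hδ : ∀ x, δ x ∈ 𝓝 x) (huv : u ≤ v) : ∃ s, IsFineSum δ h u v s := by
  let S : Set K := {x | x ≤ v ∧ ∃ s, IsFineSum δ h u x s}
  have huS : u ∈ S := ⟨huv, 0, .refl⟩
  obtain ⟨c, hcS, hc⟩ := isClosed_closure.isCompact.exists_isGreatest ⟨u, subset_closure huS⟩
  have hcv : c ≤ v := closure_minimal (fun x hx => hx.1) isClosed_Iic hcS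
  have hc' : ∃ s, IsFineSum δ h u c s := by
    obtain ⟨x, hx, hxS⟩ := mem_closure_iff_nhds.1 hcS _
      (Set.ordConnectedComponent_mem_nhds.2 (hδ c))
    obtain ⟨s, hs⟩ := hxS.2
    have hxc : x ≤ c := hc (subset_closure hxS)
    refine ⟨_, hs.step c c hxc le_rfl (Set.Ioc_subset_Icc_self.trans ?_)⟩
    rw [← Set.uIcc_of_ge hxc]
    exact hx
  rcases hcv.eq_or_lt with rfl | hlt
  · exact hc'
  exfalso
  obtain ⟨s, hs⟩ := hc'
  have key : ∀ z t s, c < z → z ≤ v → ¬ IsFineSum δ h u z (s + h t c z) := fun z t s hz hzv H =>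
    hz.not_ge (hc (subset_closure ⟨hzv, _, H⟩))
  obtain ⟨z, hz, hzδ⟩ := exists_Ico_subset_of_mem_nhds (hδ c) ⟨v, hlt⟩
  by_cases hne : ∃ y, c < y ∧ y < min z v
  · obtain ⟨y, hcy, hy⟩ := hne
    exact key y c s hcy (hy.le.trans (min_le_right _ _)) (hs.step c y le_rfl hcy.le fun p hp =>
      hzδ ⟨hp.1.le, hp.2.trans_lt (hy.trans_le (min_le_left _ _))⟩)
  -- Otherwise `min z v` is the immediate successor of `c`, so a single interval with this tag
  -- reaches it.
  · push Not at hne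
    have hcm : c < min z v := lt_min hz hlt
    refine key (min z v) (min z v) s hcm (min_le_right _ _)
      (hs.step _ _ hcm.le le_rfl fun p hp => ?_)
    rw [le_antisymm hp.2 (hne p hp.1)]
    exact mem_of_mem_nhds (hδ _)

end IsFineSum

/-! ### Integrals over subintervals -/

/-- `I` is the `G`-integral of `f` over `(a, b]`, computed from fine chains in `K` from `a` to `b`.
The gauge may be any choice of neighbourhoods. The term `f(0_K) G(0_K)` is not included. -/
def HasIntegralOn {K : Type*} [LinearOrder K] [TopologicalSpace K] (f G : K → ℝ) (a b : K)
    (I : ℝ) : Prop :=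
  ∀ ε : ℝ, 0 < ε → ∃ δ : K → Set K, (∀ x, δ x ∈ 𝓝 x) ∧
    ∀ s, IsFineSum δ (stieltjesWeight f G) a b s → |s - I| < ε

variable {K : Type*} [LinearOrder K] [TopologicalSpace K]

theorem hasIntegralOn_self (f G : K → ℝ) (a : K) : HasIntegralOn f G a a 0 := fun ε hε =>
  ⟨fun _ => Set.univ, fun _ => univ_mem, fun s hs => by
    simpa [hs.eq_zero (stieltjesWeight_self f G) rfl] using hε⟩

theorem HasIntegralOn.unique [OrderTopology K] [CompactSpace K] {f G : K → ℝ} {a b : K}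
    {I J : ℝ} (hab : a ≤ b) (hI : HasIntegralOn f G a b I) (hJ : HasIntegralOn f G a b J) :
    I = J := by
  refine eq_of_forall_dist_le fun ε hε => ?_
  obtain ⟨δ, hδ, h1⟩ := hI (ε / 2) (half_pos hε)
  obtain ⟨δ', hδ', h2⟩ := hJ (ε / 2) (half_pos hε)
  obtain ⟨s, hs⟩ := IsFineSum.exists_of_le (h := stieltjesWeight f G)
    (fun x => inter_mem (hδ x) (hδ' x)) hab
  have h3 := abs_lt.1 (h1 s (hs.mono fun x => Set.inter_subset_left))
  have h4 := abs_lt.1 (h2 s (hs.mono fun x => Set.inter_subset_right))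
  rw [Real.dist_eq, abs_le]
  constructor <;> linarith

/-- In an order topology, neighbourhoods can be shrunk to the open intervals of a gauge. -/
theorem exists_gauge_subset [OrderTopology K] {δ : K → Set K} (hδ : ∀ x, δ x ∈ 𝓝 x) :
    ∃ γ : Gauge K, ∀ x, γ.toFun x ⊆ δ x := by
  refine ⟨⟨fun x => (interior (δ x)).ordConnectedComponent x, fun x => ?_, fun x => ?_,
    fun x => ?_⟩, fun x => Set.ordConnectedComponent_subset.trans interior_subset⟩
  · refine isOpen_iff_mem_nhds.2 fun y hy => ?_
    rw [Set.ordConnectedComponent_eq hy, Set.ordConnectedComponent_mem_nhds]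
    exact isOpen_interior.mem_nhds (Set.ordConnectedComponent_subset hy)
  · infer_instance
  · exact Set.self_mem_ordConnectedComponent.2 (mem_interior_iff_mem_nhds.2 (hδ x))

theorem hasGIntegral_of_hasIntegralOn [BoundedOrder K] [OrderTopology K] {f G : K → ℝ} {I : ℝ}
    (hI : HasIntegralOn f G ⊥ ⊤ I) : HasGIntegral f G (I + f ⊥ * G ⊥) := by
  intro ε hε
  obtain ⟨δ, hδ, h⟩ := hI ε hε
  obtain ⟨γ, hγ⟩ := exists_gauge_subset hδ
  refine ⟨γ, fun P hP => ?_⟩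
  have H := IsFineSum.of_fin (δ := δ) (h := stieltjesWeight f G) P.n P.x P.t P.le_tag P.tag_le
    (fun i => (hP i).trans (hγ _))
  rw [P.x_first, P.x_last] at H
  convert h _ H using 2
  simp only [riemannSum, stieltjesWeight]
  ring

theorem HasGIntegral.hasIntegralOn [BoundedOrder K] {f G : K → ℝ} {I : ℝ}
    (hI : HasGIntegral f G I) : HasIntegralOn f G ⊥ ⊤ (I - f ⊥ * G ⊥) := by
  intro ε hε
  obtain ⟨δ, h⟩ := hI ε hε
  refine ⟨δ.toFun, fun x => (δ.isOpen x).mem_nhds (δ.mem x), fun s hs => ?_⟩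
  obtain ⟨n, x, t, h0, h1, hl, hr, hf, rfl⟩ := hs.exists_fin
  convert h ⟨n, x, t, h0, h1, hl, hr⟩ hf using 2
  simp only [riemannSum, stieltjesWeight]
  ring

/-- The integral of a restriction to the compact line `[0_K, y]` is an integral over `(0_K, y]`:
a gauge on `[0_K, y]` extends to neighbourhoods in `K`, and fine chains from `0_K` to `y` stay in
`[0_K, y]`. -/
theorem hasIntegralOn_of_domRestrict [BoundedOrder K] {f G : K → ℝ} {y : K} {I : ℝ}
    (hI : HasGIntegral ((Set.Iic y).domRestrict f) ((Set.Iic y).domRestrict G) I) :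
    HasIntegralOn f G ⊥ y (I - f ⊥ * G ⊥) := by
  intro ε hε
  obtain ⟨δ, hδ, h⟩ := hI.hasIntegralOn ε hε
  have hV : ∀ x : K, ∃ V ∈ 𝓝 x, ∀ hx : x ≤ y, (Subtype.val ⁻¹' V : Set (Set.Iic y)) ⊆ δ ⟨x, hx⟩ := by
    intro x
    by_cases hx : x ≤ y
    · obtain ⟨V, hV, hVδ⟩ := mem_nhds_subtype _ _ _ |>.1 (hδ ⟨x, hx⟩)
      exact ⟨V, hV, fun _ => hVδ⟩
    · exact ⟨Set.univ, univ_mem, fun hx' => absurd hx' hx⟩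
  choose V hV hVδ using hV
  have key : ∀ v s, IsFineSum V (stieltjesWeight f G) ⊥ v s → ∀ hv : v ≤ y,
      IsFineSum δ (stieltjesWeight ((Set.Iic y).domRestrict f) ((Set.Iic y).domRestrict G)) ⊥
        ⟨v, hv⟩ s := by
    intro v s H
    induction H with
    | refl => exact fun _ => .refl
    | @step v s t w H h1 h2 h3 ih =>
      intro hw
      refine (ih (h1.trans (h2.trans hw))).step ⟨t, h2.trans hw⟩ ⟨w, hw⟩ h1 h2 fun p hp => ?_
      exact hVδ t _ (h3 ⟨hp.1, hp.2⟩)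
  exact ⟨V, hV, fun s hs => h s (key y s hs le_rfl)⟩

theorem HasGIntegral.gIntegral_eq [BoundedOrder K] [OrderTopology K] [CompactSpace K]
    {f G : K → ℝ} {I : ℝ} (hI : HasGIntegral f G I) : gIntegral f G = I := by
  have hf : GIntegrable f G := ⟨I, hI⟩
  rw [gIntegral, dif_pos hf]
  have := hf.choose_spec.hasIntegralOn.unique bot_le hI.hasIntegralOn
  linarith

theorem GIntegrable.hasGIntegral [BoundedOrder K] {f G : K → ℝ} (hf : GIntegrable f G) :
    HasGIntegral f G (gIntegral f G) := by
  rw [gIntegral, dif_pos hf]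
  exact hf.choose_spec

/-! ### Changing the interval of integration -/

theorem eventually_imp_lt_right [OrderTopology K] (x c : K) : ∀ᶠ w in 𝓝 x, x < c → w < c :=
  eventually_imp_distrib_left.2 fun hx => gt_mem_nhds hx

theorem eventually_imp_lt_left [OrderTopology K] (x c : K) : ∀ᶠ w in 𝓝 x, c < x → c < w :=
  eventually_imp_distrib_left.2 fun hx => lt_mem_nhds hx

/-- Right-continuity makes `G`-increments to the right of `c` small. This bounds the error made
when an interval with tag `c` is cut at `c`. -/
theorem eventually_mul_sub_lt {G : K → ℝ} {c : K}
    (hGc : ContinuousWithinAt G (Set.Ici c) c) (C : ℝ) {ε : ℝ} (hε : 0 < ε) :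
    ∀ᶠ w in 𝓝 c, c ≤ w → |C * (G w - G c)| < ε := by
  have h : Tendsto (fun w => |C * (G w - G c)|) (𝓝[≥] c) (𝓝 |C * (G c - G c)|) :=
    ((hGc.sub_const _).const_mul C).abs
  rw [sub_self, mul_zero, abs_zero] at h
  exact eventually_nhdsWithin_iff.1 (h.eventually (gt_mem_nhds hε))

/-- If the terms with tags in `(c, y]` vanish, then the integral over `(a, c]` is also the integral
over `(a, y]`, and one gauge serves all such `y`. The gauge forces every interval that meets both
`[0_K, c]` and `(c, 1_K]` to have tag `c` or to begin at `c`. -/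
theorem HasIntegralOn.exists_extend_right [OrderTopology K] {f g G : K → ℝ} {a c : K} {I : ℝ}
    (hac : a ≤ c) (hI : HasIntegralOn f G a c I) (hGc : ContinuousWithinAt G (Set.Ici c) c)
    (hfg : ∀ x ≤ c, g x = f x) {ε : ℝ} (hε : 0 < ε) :
    ∃ δ : K → Set K, (∀ x, δ x ∈ 𝓝 x) ∧ ∀ y, c ≤ y →
      (∀ t v w, c < t → c ≤ v → v ≤ w → w ≤ y → g t * (G w - G v) = 0) →
      ∀ s, IsFineSum δ (stieltjesWeight g G) a y s → |s - I| < ε := by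
  obtain ⟨δ, hδ, h⟩ := hI (ε / 2) (half_pos hε)
  let γ : K → Set K := fun x => {w | w ∈ δ x ∧ (x < c → w < c) ∧ (c < x → c < w) ∧
    (x = c → c ≤ w → |f c * (G w - G c)| < ε / 2)}
  refine ⟨γ, fun x => ?_, fun y hcy h0 => ?_⟩
  · have h1 : ∀ᶠ w in 𝓝 x, x < c → w < c := eventually_imp_lt_right x c
    have h2 : ∀ᶠ w in 𝓝 x, c < x → c < w := eventually_imp_lt_left x c
    have h3 : ∀ᶠ w in 𝓝 x, x = c → c ≤ w → |f c * (G w - G c)| < ε / 2 := by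
      by_cases hx : x = c
      · subst hx
        filter_upwards [eventually_mul_sub_lt hGc (f x) (half_pos hε)] with w hw _ using hw
      · exact .of_forall fun w hw => absurd hw hx
    filter_upwards [hδ x, h1, h2, h3] with w a1 a2 a3 a4 using ⟨a1, a2, a3, a4⟩
  · have key : ∀ v s, IsFineSum γ (stieltjesWeight g G) a v s → v ≤ y →
        (v ≤ c → IsFineSum δ (stieltjesWeight f G) a v s) ∧
        (c ≤ v → ∃ s', IsFineSum δ (stieltjesWeight f G) a c s' ∧ |s - s'| < ε / 2) := by
      intro v s H
      induction H with
      | refl =>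
        refine fun _ => ⟨fun _ => .refl, fun hca => ?_⟩
        obtain rfl := le_antisymm hac hca
        exact ⟨0, .refl, by simpa using hε⟩
      | @step v s t w H h1 h2 h3 ih =>
        intro hwy
        obtain ⟨ih1, ih2⟩ := ih (h1.trans (h2.trans hwy))
        have hA : w ≤ c → IsFineSum δ (stieltjesWeight f G) a w (s + stieltjesWeight g G t v w) := by
          intro hwc
          have := (ih1 (h1.trans (h2.trans hwc))).step (δ := δ) t w h1 h2 fun p hp => (h3 hp).1
          simpa [stieltjesWeight, hfg t (h2.trans hwc)] using this
        refine ⟨hA, fun hcw => ?_⟩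
        obtain rfl | hcw := hcw.eq_or_lt
        · exact ⟨_, hA le_rfl, by simpa using hε⟩
        rcases le_or_gt v c with hvc | hcv
        · by_cases htc : t = c
          · subst htc
            refine ⟨_, (ih1 hvc).step t t hvc le_rfl fun p hp => (h3 ⟨hp.1, hp.2.trans h2⟩).1, ?_⟩
            have := (h3 ⟨hvc.trans_lt hcw, le_rfl⟩).2.2.2 rfl hcw.le
            convert this using 2
            simp only [stieltjesWeight, hfg t le_rfl]
            ring
          · have hwt := h3 ⟨hvc.trans_lt hcw, le_rfl⟩
            have hct : c < t := lt_of_le_of_ne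
              (not_lt.1 fun htc' => (hwt.2.1 htc').not_ge hcw.le) (Ne.symm htc)
            obtain rfl | hvc := hvc.eq_or_lt
            · refine ⟨s, ih1 le_rfl, ?_⟩
              simpa [stieltjesWeight, h0 t v w hct le_rfl (h1.trans h2) hwy] using hε
            · exact absurd ((h3 ⟨hvc, hcw.le⟩).2.2.1 hct) (lt_irrefl c)
        · obtain ⟨s', hs', hd⟩ := ih2 hcv.le
          refine ⟨s', hs', ?_⟩
          simpa [stieltjesWeight, h0 t v w (hcv.trans_le h1) hcv.le (h1.trans h2) hwy] using hd
    intro s hs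
    obtain ⟨s', hs', hd⟩ := (key y s hs le_rfl).2 hcy
    have h4 := abs_lt.1 (h s' hs')
    have h5 := abs_lt.1 hd
    rw [abs_lt]
    constructor <;> linarith

/-- If `g` is `f` cut off to `(c, b]`, then the integral of `g` over `(a, b]` is that of `f` over
`(c, b]`. Only an interval beginning at `c` with tag `c` distinguishes the two, and the gauge makes
its contribution small. -/
theorem HasIntegralOn.of_cutoff_left [OrderTopology K] [CompactSpace K] {f g G : K → ℝ}
    {a b c : K} {I : ℝ} (hac : a ≤ c) (hI : HasIntegralOn g G a b I)
    (hGc : ContinuousWithinAt G (Set.Ici c) c) (hg0 : ∀ x ≤ c, g x = 0)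
    (hgf : ∀ x, c < x → g x = f x) : HasIntegralOn f G c b I := by
  intro ε hε
  obtain ⟨δ, hδ, h⟩ := hI (ε / 2) (half_pos hε)
  let γ : K → Set K := fun x => {w | w ∈ δ x ∧ (x = c → c ≤ w → |f c * (G w - G c)| < ε / 2)}
  refine ⟨γ, fun x => ?_, fun s hs => ?_⟩
  · have h3 : ∀ᶠ w in 𝓝 x, x = c → c ≤ w → |f c * (G w - G c)| < ε / 2 := by
      by_cases hx : x = c
      · subst hx
        filter_upwards [eventually_mul_sub_lt hGc (f x) (half_pos hε)] with w hw _ using hw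
      · exact .of_forall fun w hw => absurd hw hx
    filter_upwards [hδ x, h3] with w a1 a2 using ⟨a1, a2⟩
  · have hz : ∀ v s, IsFineSum δ (stieltjesWeight g G) a v s → v ≤ c → s = 0 := by
      intro v s H
      induction H with
      | refl => exact fun _ => rfl
      | @step v s t w H h1 h2 h3 ih =>
        intro hw
        simp [ih (h1.trans (h2.trans hw)), stieltjesWeight, hg0 t (h2.trans hw)]
    have key : ∀ v s, IsFineSum γ (stieltjesWeight f G) c v s →
        ∃ s', IsFineSum δ (stieltjesWeight g G) c v s' ∧ |s - s'| < ε / 2 ∧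
          (v = c → s = s') := by
      intro v s H
      induction H with
      | refl => exact ⟨0, .refl, by simpa using hε, fun _ => rfl⟩
      | @step v s t w H h1 h2 h3 ih =>
        obtain ⟨s', hs', hd, he⟩ := ih
        refine ⟨_, hs'.step t w h1 h2 fun p hp => (h3 hp).1, ?_⟩
        obtain hct | hct := (H.le.trans h1).lt_or_eq
        · have : stieltjesWeight f G t v w = stieltjesWeight g G t v w := by
            simp [stieltjesWeight, hgf t hct]
          rw [this, add_sub_add_right_eq_sub]
          exact ⟨hd, fun hw => absurd (hct.trans_le h2) (hw ▸ lt_irrefl c)⟩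
        · have hvc : v = c := le_antisymm (hct ▸ h1) H.le
          subst hvc
          rw [he rfl, add_sub_add_left_eq_sub]
          obtain rfl | hlt := (h1.trans h2).eq_or_lt
          · simpa [stieltjesWeight_self] using hε
          · refine ⟨?_, fun hw => absurd hw hlt.ne'⟩
            have := (h3 ⟨hlt, le_rfl⟩).2 hct.symm hlt.le
            simpa [stieltjesWeight, ← hct, hg0 v le_rfl] using this
    obtain ⟨s', hs', hd, -⟩ := key b s hs
    obtain ⟨s₀, hs₀⟩ := IsFineSum.exists_of_le (h := stieltjesWeight g G) hδ hac
    obtain rfl := hz c s₀ hs₀ le_rfl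
    have h4 := abs_lt.1 (h _ (hs₀.trans hs'))
    have h5 := abs_lt.1 hd
    rw [abs_lt]
    constructor <;> linarith

/-- If `G` is constant on `[a, c]`, then the integral over `(c, b]` is also the integral over
`(a, b]`. -/
theorem HasIntegralOn.extend_left_of_const [OrderTopology K] {f G : K → ℝ} {a b c : K} {I : ℝ}
    (hac : a ≤ c) (hcb : c ≤ b) (hI : HasIntegralOn f G c b I)
    (hGc : ∀ x, a ≤ x → x ≤ c → G x = G c) : HasIntegralOn f G a b I := by
  intro ε hε
  obtain ⟨δ, hδ, h⟩ := hI ε hε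
  let γ : K → Set K := fun x => {w | w ∈ δ x ∧ (x < c → w < c) ∧ (c < x → c < w)}
  refine ⟨γ, fun x => ?_, fun s hs => ?_⟩
  · have h1 : ∀ᶠ w in 𝓝 x, x < c → w < c := eventually_imp_lt_right x c
    have h2 : ∀ᶠ w in 𝓝 x, c < x → c < w := eventually_imp_lt_left x c
    filter_upwards [hδ x, h1, h2] with w a1 a2 a3 using ⟨a1, a2, a3⟩
  · have key : ∀ v s, IsFineSum γ (stieltjesWeight f G) a v s →
        (v ≤ c → s = 0) ∧ (c ≤ v → IsFineSum δ (stieltjesWeight f G) c v s) := by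
      intro v s H
      induction H with
      | refl =>
        refine ⟨fun _ => rfl, fun hca => ?_⟩
        obtain rfl := le_antisymm hac hca
        exact .refl
      | @step v s t w H h1 h2 h3 ih =>
        obtain ⟨ih1, ih2⟩ := ih
        have hA : w ≤ c → s + stieltjesWeight f G t v w = 0 := by
          intro hw
          have hvc := (h1.trans h2).trans hw
          simp [ih1 hvc, stieltjesWeight, hGc v H.le hvc, hGc w (H.le.trans (h1.trans h2)) hw]
        refine ⟨hA, fun hcw => ?_⟩
        obtain rfl | hcw := hcw.eq_or_lt
        · rw [hA le_rfl]; exact .refl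
        obtain hvc | hcv := lt_or_ge v c
        · have htc : t = c := by
            refine le_antisymm (not_lt.1 fun hlt => ?_) (not_lt.1 fun hlt => ?_)
            · exact absurd ((h3 ⟨hvc, hcw.le⟩).2.2 hlt) (lt_irrefl c)
            · exact absurd ((h3 ⟨hvc, hcw.le⟩).2.1 hlt) (lt_irrefl c)
          subst htc
          have := IsFineSum.single (δ := δ) (h := stieltjesWeight f G) t le_rfl h2
            fun p hp => (h3 ⟨hvc.trans hp.1, hp.2⟩).1
          simpa [ih1 hvc.le, stieltjesWeight, hGc v H.le hvc.le] using this
        · exact (ih2 hcv).step t w h1 h2 fun p hp => (h3 hp).1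
    exact h s ((key b s hs).2 hcb)

/-! ### Henstock's lemma -/

/-- Every gauge admits fine sums over `(v, w]` arbitrarily close to `I`. -/
def HasFineSumsNear (f G : K → ℝ) (v w : K) (I : ℝ) : Prop :=
  ∀ δ : K → Set K, (∀ x, δ x ∈ 𝓝 x) → ∀ η : ℝ, 0 < η →
    ∃ r, IsFineSum δ (stieltjesWeight f G) v w r ∧ |r - I| < η

theorem HasIntegralOn.hasFineSumsNear_right [OrderTopology K] [CompactSpace K] {f G : K → ℝ}
    {a v w : K} {I J : ℝ} (hav : a ≤ v) (hvw : v ≤ w) (hI : HasIntegralOn f G a v I)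
    (hJ : HasIntegralOn f G a w J) : HasFineSumsNear f G v w (J - I) := by
  intro δ hδ η hη
  obtain ⟨δ₁, hδ₁, h1⟩ := hI (η / 2) (half_pos hη)
  obtain ⟨δ₂, hδ₂, h2⟩ := hJ (η / 2) (half_pos hη)
  obtain ⟨s, hs⟩ := IsFineSum.exists_of_le (h := stieltjesWeight f G)
    (fun x => inter_mem (hδ₁ x) (hδ₂ x)) hav
  obtain ⟨r, hr⟩ := IsFineSum.exists_of_le (h := stieltjesWeight f G)
    (fun x => inter_mem (hδ x) (hδ₂ x)) hvw
  refine ⟨r, hr.mono fun x => Set.inter_subset_left, ?_⟩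
  have h3 := abs_lt.1 (h1 s (hs.mono fun x => Set.inter_subset_left))
  have h4 := abs_lt.1 (h2 _ ((hs.mono fun x => Set.inter_subset_right).trans
    (hr.mono fun x => Set.inter_subset_right)))
  rw [abs_lt]
  constructor <;> linarith

theorem HasIntegralOn.hasFineSumsNear_left [OrderTopology K] [CompactSpace K] {f G : K → ℝ}
    {b v w : K} {I J : ℝ} (hvw : v ≤ w) (hwb : w ≤ b) (hI : HasIntegralOn f G v b I)
    (hJ : HasIntegralOn f G w b J) : HasFineSumsNear f G v w (I - J) := by
  intro δ hδ η hη
  obtain ⟨δ₁, hδ₁, h1⟩ := hI (η / 2) (half_pos hη)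
  obtain ⟨δ₂, hδ₂, h2⟩ := hJ (η / 2) (half_pos hη)
  obtain ⟨s, hs⟩ := IsFineSum.exists_of_le (h := stieltjesWeight f G)
    (fun x => inter_mem (hδ₁ x) (hδ₂ x)) hwb
  obtain ⟨r, hr⟩ := IsFineSum.exists_of_le (h := stieltjesWeight f G)
    (fun x => inter_mem (hδ x) (hδ₁ x)) hvw
  refine ⟨r, hr.mono fun x => Set.inter_subset_left, ?_⟩
  have h3 := abs_lt.1 (h1 _ ((hr.mono fun x => Set.inter_subset_right).trans
    (hs.mono fun x => Set.inter_subset_left)))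
  have h4 := abs_lt.1 (h2 s (hs.mono fun x => Set.inter_subset_right))
  rw [abs_lt]
  constructor <;> linarith

open Classical in
/-- The deviation `f(t) (G(w) - G(v)) - (F(w) - F(v))` of a Riemann term from the increment of a
primitive `F`, counted only for tags in `T`. -/
noncomputable def deviation (f G F : K → ℝ) (T : Set K) (t v w : K) : ℝ :=
  if t ∈ T then stieltjesWeight f G t v w - (F w - F v) else 0

/-- **Henstock's lemma**: if the fine sums over `(a, b]` are within `ε` of the integral, then so are
the partial sums over any selection of the intervals, here those with tag in `T`. The intervals that
are not selected are replaced by fine chains whose sums are as close as desired to the increments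
of `F`. The chain may extend beyond `[a, b]`, as long as the selected intervals do not. -/
theorem IsFineSum.abs_deviation_le {f G F : K → ℝ} {a b u v : K} {δ γ : K → Set K} {T : Set K}
    {ε s : ℝ} (hab : a ≤ b) (hδ : ∀ x, δ x ∈ 𝓝 x)
    (h : ∀ s, IsFineSum δ (stieltjesWeight f G) a b s → |s - (F b - F a)| ≤ ε)
    (hF : ∀ v w, a ≤ v → v ≤ w → w ≤ b → HasFineSumsNear f G v w (F w - F v))
    (hγ : ∀ t ∈ T, ∀ v w, v < w → v ≤ t → t ≤ w → Set.Ioc v w ⊆ γ t →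
      a ≤ v ∧ w ≤ b ∧ Set.Ioc v w ⊆ δ t)
    (H : IsFineSum γ (deviation f G F T) u v s) : |s| ≤ ε := by
  -- Clamping to `[a, b]` turns a chain from `u` to `v` into one inside `[a, b]`.
  let p : K → K := fun x => max a (min x b)
  have hpm : Monotone p := fun x y hxy => max_le_max le_rfl (min_le_min hxy le_rfl)
  have hap : ∀ x, a ≤ p x := fun x => le_max_left _ _
  have hpb : ∀ x, p x ≤ b := fun x => max_le hab (min_le_right _ _)
  have hp : ∀ x, a ≤ x → x ≤ b → p x = x := fun x h1 h2 => by simp [p, h1, h2]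
  have key : ∀ v s, IsFineSum γ (deviation f G F T) u v s → ∀ η : ℝ, 0 < η →
      ∃ s', IsFineSum δ (stieltjesWeight f G) (p u) (p v) s' ∧
        |s' - (F (p v) - F (p u)) - s| < η := by
    intro v s H
    induction H with
    | refl => exact fun η hη => ⟨0, .refl, by simpa using hη⟩
    | @step v s t w H h1 h2 h3 ih =>
      intro η hη
      by_cases htT : t ∈ T
      · obtain ⟨s', hs', hd⟩ := ih η hη
        obtain rfl | hlt := (h1.trans h2).eq_or_lt
        · exact ⟨s', hs', by simpa [deviation, stieltjesWeight_self] using hd⟩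
        obtain ⟨hav, hwb, hsub⟩ := hγ t htT v w hlt h1 h2 h3
        rw [hp v hav (hlt.le.trans hwb)] at hs' hd
        rw [hp w (hav.trans hlt.le) hwb]
        refine ⟨_, hs'.step t w h1 h2 hsub, ?_⟩
        convert hd using 2
        simp only [deviation, if_pos htT]
        ring
      · obtain ⟨s', hs', hd⟩ := ih (η / 2) (half_pos hη)
        obtain ⟨r, hr, hrd⟩ := hF (p v) (p w) (hap v) (hpm (h1.trans h2)) (hpb w) δ hδ (η / 2)
          (half_pos hη)
        refine ⟨_, hs'.trans hr, ?_⟩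
        have h4 := abs_lt.1 hd
        have h5 := abs_lt.1 hrd
        simp only [deviation, if_neg htT]
        rw [abs_lt]
        constructor <;> linarith
  refine le_of_forall_pos_lt_add fun η hη => ?_
  obtain ⟨s', hs', hd⟩ := key v s H (η / 3) (by linarith)
  obtain ⟨r, hr, hrd⟩ := hF a (p u) le_rfl (hap u) (hpb u) δ hδ (η / 3) (by linarith)
  obtain ⟨q, hq, hqd⟩ := hF (p v) b (hap v) (hpb v) le_rfl δ hδ (η / 3) (by linarith)
  have h3 := abs_le.1 (h _ ((hr.trans hs').trans hq))
  have h4 := abs_lt.1 hd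
  have h5 := abs_lt.1 hrd
  have h6 := abs_lt.1 hqd
  rw [abs_lt]
  constructor <;> linarith

/-- Gauges for countably many intervals `[a n, b n]` that exhaust an interval `J` combine to a gauge
for which the fine sums over all subintervals of `J` are uniformly close to the increments of the
primitive `F`. A tag `t` uses the gauge of the interval with index `lev t`, on which the error is a
term of a geometric series, and Henstock's lemma bounds the contribution of each index. -/
theorem exists_uniform_gauge {f G F : K → ℝ} {J : Set K} (hJ : J.OrdConnected) {a b : ℕ → K}
    (haJ : ∀ n, a n ∈ J) (hbJ : ∀ n, b n ∈ J) (hab : ∀ n, a n ≤ b n)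
    (hint : ∀ n, HasIntegralOn f G (a n) (b n) (F (b n) - F (a n)))
    (hF : ∀ v ∈ J, ∀ w ∈ J, v ≤ w → HasFineSumsNear f G v w (F w - F v))
    {lev : K → ℕ} {V : K → Set K} (hV : ∀ t, V t ∈ 𝓝 t)
    (hlev : ∀ t ∈ J, ∀ v w, v < w → v ≤ t → t ≤ w → Set.Ioc v w ⊆ V t →
      a (lev t) ≤ v ∧ w ≤ b (lev t))
    (hfin : ∀ u ∈ J, ∀ v ∈ J, ∃ N, ∀ t ∈ Set.Icc u v, lev t < N) {ε : ℝ} (hε : 0 < ε) :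
    ∃ γ : K → Set K, (∀ x, γ x ∈ 𝓝 x) ∧ ∀ u ∈ J, ∀ v ∈ J, ∀ s,
      IsFineSum γ (stieltjesWeight f G) u v s → |s - (F v - F u)| < ε := by
  have hε' : ∀ n : ℕ, 0 < ε / 4 * (1 / 2) ^ n := fun n => by positivity
  choose δ hδ h using fun n => hint n _ (hε' n)
  refine ⟨fun t => V t ∩ δ (lev t) t, fun x => inter_mem (hV x) (hδ _ x),
    fun u hu v hv s hs => ?_⟩
  obtain ⟨N, hN⟩ := hfin u hu v hv
  let T : ℕ → Set K := fun n => {t | t ∈ J ∧ lev t = n}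
  have key : ∀ w s, IsFineSum (fun t => V t ∩ δ (lev t) t) (stieltjesWeight f G) u w s → w ≤ v →
      ∃ σ : ℕ → ℝ, (∀ n, IsFineSum (fun t => V t ∩ δ (lev t) t) (deviation f G F (T n)) u w (σ n)) ∧
        s - (F w - F u) = ∑ n ∈ Finset.range N, σ n := by
    intro w s H
    induction H with
    | refl => exact fun _ => ⟨fun _ => 0, fun _ => .refl, by simp⟩
    | @step y s t w H h1 h2 h3 ih =>
      intro hw
      obtain ⟨σ, hσ, he⟩ := ih ((h1.trans h2).trans hw)
      refine ⟨_, fun n => (hσ n).step t w h1 h2 h3, ?_⟩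
      have ht : t ∈ Set.Icc u v := ⟨H.le.trans h1, h2.trans hw⟩
      have htJ : t ∈ J := hJ.out hu hv ht
      rw [Finset.sum_add_distrib, ← he]
      have : ∑ n ∈ Finset.range N, deviation f G F (T n) t y w =
          stieltjesWeight f G t y w - (F w - F y) := by
        rw [Finset.sum_eq_single (lev t)]
        · exact if_pos ⟨htJ, rfl⟩
        · exact fun n _ hn => if_neg fun h => hn h.2.symm
        · exact fun hn => absurd (Finset.mem_range.2 (hN t ht)) hn
      rw [this]
      ring
  obtain ⟨σ, hσ, he⟩ := key v s hs le_rfl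
  have hb : ∀ n, |σ n| ≤ ε / 4 * (1 / 2) ^ n := by
    intro n
    refine (hσ n).abs_deviation_le (hab n) (hδ n) (fun s hs => (h n s hs).le)
      (fun v w h1 h2 h3 => hF v (hJ.out (haJ n) (hbJ n) ⟨h1, h2.trans h3⟩) w
        (hJ.out (haJ n) (hbJ n) ⟨h1.trans h2, h3⟩) h2) ?_
    rintro t ⟨htJ, rfl⟩ v w hvw h1 h2 h3
    obtain ⟨h4, h5⟩ := hlev t htJ v w hvw h1 h2 (h3.trans Set.inter_subset_left)
    exact ⟨h4, h5, h3.trans Set.inter_subset_right⟩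
  rw [he]
  calc |∑ n ∈ Finset.range N, σ n| ≤ ∑ n ∈ Finset.range N, |σ n| := Finset.abs_sum_le_sum_abs _ _
    _ ≤ ∑ n ∈ Finset.range N, ε / 4 * (1 / 2) ^ n := Finset.sum_le_sum fun n _ => hb n
    _ = ε / 4 * ∑ n ∈ Finset.range N, (1 / 2 : ℝ) ^ n := (Finset.mul_sum _ _ _).symm
    _ ≤ ε / 4 * 2 := by gcongr; exact sum_geometric_two_le N
    _ < ε := by linarith

/-! ### Hake's theorem at the right end -/

/-- The Riemann sums over `(0_K, y]` are uniformly close to `F y` for `y < 1_K` near `1_K`. Either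
`G` is constant near `1_K`, and the integrals over `(0_K, y]` stabilize, or values of `G` below its
left limit `L` at `1_K` yield a sequence cofinal in `[0_K, 1_K)`, even though `K` need not be
first countable. -/
theorem exists_uniform_gauge_right [BoundedOrder K] [OrderTopology K] [CompactSpace K]
    {f G F : K → ℝ} {L : ℝ} (hG : Monotone G)
    (hGr : ∀ x : K, ContinuousWithinAt G (Set.Ici x) x) [(𝓝[<] (⊤ : K)).NeBot]
    (hL : Tendsto G (𝓝[<] (⊤ : K)) (𝓝 L))
    (hF : ∀ y < ⊤, HasIntegralOn f G ⊥ y (F y)) :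
    ∃ c : K, c < ⊤ ∧ ∀ ε : ℝ, 0 < ε → ∃ δ : K → Set K, (∀ x, δ x ∈ 𝓝 x) ∧
      ∀ y, c ≤ y → y < ⊤ → ∀ s, IsFineSum δ (stieltjesWeight f G) ⊥ y s → |s - F y| < ε := by
  have hlt : ∀ᶠ y in 𝓝[<] (⊤ : K), y < ⊤ := self_mem_nhdsWithin
  have hGL : ∀ y < ⊤, G y ≤ L := fun y hy => ge_of_tendsto hL (by
    filter_upwards [Ioo_mem_nhdsLT hy] with z hz using hG hz.1.le)
  have hseq : ∀ n : ℕ, ∃ y : K, y < ⊤ ∧ L - 1 / ((n : ℝ) + 1) < G y := fun n =>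
    (hlt.and (hL.eventually (lt_mem_nhds (sub_lt_self L Nat.one_div_pos_of_nat)))).exists
  choose y hyt hyG using hseq
  by_cases hcof : ∀ z < ⊤, ∃ n, z < y n
  · classical
    have hF0 : F ⊥ = 0 := (hF ⊥ (bot_le.trans_lt (hyt 0))).unique le_rfl (hasIntegralOn_self f G ⊥)
    let lev : K → ℕ := fun t => if h : ∃ n, t < y n then Nat.find h else 0
    have hlev : ∀ t < ⊤, t < y (lev t) := fun t ht => by
      simp only [lev, dif_pos (hcof t ht)]
      exact Nat.find_spec (hcof t ht)
    refine ⟨y 0, hyt 0, fun ε hε => ?_⟩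
    obtain ⟨γ, hγ, h⟩ := exists_uniform_gauge (J := Set.Iio (⊤ : K)) Set.ordConnected_Iio
      (f := f) (G := G) (F := F) (a := fun _ => ⊥) (b := y) (lev := lev)
      (V := fun t => {w | t < ⊤ → w < y (lev t)})
      (fun n => bot_le.trans_lt (hyt n)) hyt (fun n => bot_le)
      (fun n => by rw [hF0, sub_zero]; exact hF _ (hyt n))
      (fun v hv w hw hvw => (hF v hv).hasFineSumsNear_right bot_le hvw (hF w hw))
      (fun t => by
        by_cases ht : t < ⊤
        · filter_upwards [gt_mem_nhds (hlev t ht)] with w hw _ using hw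
        · exact Eventually.of_forall fun w hw => absurd hw ht)
      (fun t ht v w hvw _ _ hs => ⟨bot_le, (hs ⟨hvw, le_rfl⟩ ht).le⟩)
      (fun u hu v hv => by
        obtain ⟨N, hN⟩ := hcof v hv
        refine ⟨N + 1, fun t ht => Nat.lt_succ_of_le ?_⟩
        have hex : ∃ n, t < y n := ⟨N, ht.2.trans_lt hN⟩
        simp only [lev, dif_pos hex]
        exact Nat.find_min' hex (ht.2.trans_lt hN)) hε
    refine ⟨γ, hγ, fun z _ hz s hs => ?_⟩
    simpa [hF0] using h ⊥ (bot_le.trans_lt hz) z hz s hs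
  · push Not at hcof
    obtain ⟨c, hc, hyc⟩ := hcof
    have hLc : L ≤ G c := by
      have h0 : Tendsto (fun n : ℕ => L - 1 / ((n : ℝ) + 1)) atTop (𝓝 (L - 0)) :=
        tendsto_one_div_add_atTop_nhds_zero_nat.const_sub L
      rw [sub_zero] at h0
      exact le_of_tendsto' h0 fun n => (hyG n).le.trans (hG (hyc n))
    have hGc : ∀ x, c ≤ x → x < ⊤ → G x = L := fun x h1 h2 =>
      le_antisymm (hGL x h2) (hLc.trans (hG h1))
    have key : ∀ ε : ℝ, 0 < ε → ∃ δ : K → Set K, (∀ x, δ x ∈ 𝓝 x) ∧ ∀ z, c ≤ z → z < ⊤ →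
        ∀ s, IsFineSum δ (stieltjesWeight f G) ⊥ z s → |s - F c| < ε := by
      intro ε hε
      obtain ⟨δ, hδ, h⟩ := (hF c hc).exists_extend_right bot_le (hGr c) (g := f)
        (fun _ _ => rfl) hε
      refine ⟨δ, hδ, fun z hcz hz s hs => h z hcz (fun t v w _ h2 h3 h4 => ?_) s hs⟩
      rw [hGc w (h2.trans h3) (h4.trans_lt hz), hGc v h2 (h3.trans_lt (h4.trans_lt hz)), sub_self,
        mul_zero]
    refine ⟨c, hc, fun ε hε => ?_⟩
    obtain ⟨δ, hδ, h⟩ := key ε hε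
    refine ⟨δ, hδ, fun z hcz hz s hs => ?_⟩
    have : F z = F c := (hF z hz).unique bot_le fun ε hε => by
      obtain ⟨δ, hδ, h⟩ := key ε hε
      exact ⟨δ, hδ, h z hcz hz⟩
    rw [this]
    exact h z hcz hz s hs

/-- Hake's theorem at `1_K`, for the integral over `(0_K, 1_K]`. The gauge forces the last
nondegenerate interval to have tag `1_K`, which produces the jump term. -/
theorem hasIntegralOn_top_of_tendsto [BoundedOrder K] [OrderTopology K] [CompactSpace K]
    {f G F : K → ℝ} {A L : ℝ} (hG : Monotone G)
    (hGr : ∀ x : K, ContinuousWithinAt G (Set.Ici x) x) [(𝓝[<] (⊤ : K)).NeBot]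
    (hL : Tendsto G (𝓝[<] (⊤ : K)) (𝓝 L))
    (hF : ∀ y < ⊤, HasIntegralOn f G ⊥ y (F y)) (hA : Tendsto F (𝓝[<] (⊤ : K)) (𝓝 A)) :
    HasIntegralOn f G ⊥ ⊤ (A + f ⊤ * (G ⊤ - L)) := by
  obtain ⟨c, hc, hunif⟩ := exists_uniform_gauge_right hG hGr hL hF
  intro ε hε
  obtain ⟨δ, hδ, h⟩ := hunif (ε / 3) (by linarith)
  have hjump : Tendsto (fun y => f ⊤ * (G ⊤ - G y)) (𝓝[<] (⊤ : K)) (𝓝 (f ⊤ * (G ⊤ - L))) :=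
    (hL.const_sub _).const_mul _
  have hev : ∀ᶠ y in 𝓝[<] (⊤ : K), |F y - A| < ε / 3 ∧
      |f ⊤ * (G ⊤ - G y) - f ⊤ * (G ⊤ - L)| < ε / 3 := by
    have h1 := Metric.tendsto_nhds.1 hA (ε / 3) (by linarith)
    have h2 := Metric.tendsto_nhds.1 hjump (ε / 3) (by linarith)
    simpa only [Real.dist_eq] using h1.and h2
  obtain ⟨l, hl, hlev⟩ := (mem_nhdsLT_iff_exists_Ioo_subset' hc).1
    (inter_mem hev (Ioo_mem_nhdsLT hc))
  obtain ⟨z, hz⟩ := (Ioo_mem_nhdsLT hl : Set.Ioo l ⊤ ∈ 𝓝[<] (⊤ : K)) |> Filter.nonempty_of_mem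
  let γ : K → Set K := fun x => {w | w ∈ δ x ∧ (x < ⊤ → w < ⊤) ∧ (x = ⊤ → z < w)}
  refine ⟨γ, fun x => ?_, fun s hs => ?_⟩
  · have h1 : ∀ᶠ w in 𝓝 x, x < ⊤ → w < ⊤ := eventually_imp_lt_right x ⊤
    have h2 : ∀ᶠ w in 𝓝 x, x = ⊤ → z < w := by
      by_cases hx : x = ⊤
      · subst hx
        filter_upwards [lt_mem_nhds hz.2] with w hw _ using hw
      · exact Eventually.of_forall fun w hw => absurd hw hx
    filter_upwards [hδ x, h1, h2] with w a1 a2 a3 using ⟨a1, a2, a3⟩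
  have key : ∀ v s, IsFineSum γ (stieltjesWeight f G) ⊥ v s →
      (v = ⊤ → ∃ y s', z ≤ y ∧ y < ⊤ ∧ IsFineSum γ (stieltjesWeight f G) ⊥ y s' ∧
        s = s' + f ⊤ * (G ⊤ - G y)) := by
    intro v s H
    induction H with
    | refl => exact fun hbt => absurd hbt (bot_le.trans_lt hc).ne
    | @step v s t w H h1 h2 h3 ih =>
      intro hw
      subst hw
      obtain rfl | hlt := eq_or_ne v ⊤
      · simpa [stieltjesWeight_self] using ih rfl
      have hvt := hlt.lt_top
      have ht : t = ⊤ := not_lt_top_iff.1 fun ht => absurd ((h3 ⟨hvt, le_rfl⟩).2.1 ht) (lt_irrefl _)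
      subst ht
      exact ⟨v, s, not_lt.1 fun hvz => absurd ((h3 ⟨hvz, le_top⟩).2.2 rfl) (lt_irrefl z), hvt, H,
        rfl⟩
  obtain ⟨y, s', hzy, hy, hs', rfl⟩ := key ⊤ s hs rfl
  obtain ⟨hy1, hy2⟩ := hlev ⟨hz.1.trans_le hzy, hy⟩
  have h3 := abs_lt.1 (h y hy2.1.le hy s' (hs'.mono fun x w hw => hw.1))
  have h4 := abs_lt.1 hy1.1
  have h5 := abs_lt.1 hy1.2
  rw [abs_lt]
  constructor <;> linarith

/-! ### Hake's theorem at the left end -/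

/-- Hake's theorem at `0_K`, for the integral over `(0_K, 1_K]`. If `G` is constant near `0_K`, the
integrals `H y` over `(y, 1_K]` stabilize. Otherwise values of `G` above `G(0_K)` yield a sequence
coinitial in `(0_K, 1_K]`, which gives a gauge uniform in `y`; the gauge also forces the first
nondegenerate interval to have tag `0_K`, and its contribution is small by right-continuity. -/
theorem hasIntegralOn_bot_of_tendsto [BoundedOrder K] [OrderTopology K] [CompactSpace K]
    {f G H : K → ℝ} {B : ℝ} (hG : Monotone G)
    (hGr : ∀ x : K, ContinuousWithinAt G (Set.Ici x) x) (hd : RightDense (⊥ : K))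
    (hH : ∀ y, ⊥ < y → HasIntegralOn f G y ⊤ (H y)) (hB : Tendsto H (𝓝[>] (⊥ : K)) (𝓝 B)) :
    HasIntegralOn f G ⊥ ⊤ B := by
  have hbt : (⊥ : K) < ⊤ := hd.1
  have hdense : ∀ x : K, ⊥ < x → ∃ a, ⊥ < a ∧ a < x := fun x hx => by
    by_contra! hcon
    exact hd.2 ⟨x, hx, fun a h1 h2 => (hcon a h1).not_gt h2⟩
  have hne : (𝓝[>] (⊥ : K)).NeBot := by
    refine ⟨fun h => ?_⟩
    rcases nhdsGT_eq_bot_iff.1 h with h | h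
    · exact (h ⊤).not_gt hbt
    · exact hd.2 h
  have hgt : ∀ᶠ y in 𝓝[>] (⊥ : K), ⊥ < y := self_mem_nhdsWithin
  have hG0 : Tendsto G (𝓝[>] (⊥ : K)) (𝓝 (G ⊥)) :=
    (hGr ⊥).mono_left (nhdsWithin_mono _ Set.Ioi_subset_Ici_self)
  have hseq : ∀ n : ℕ, ∃ y : K, ⊥ < y ∧ G y < G ⊥ + 1 / ((n : ℝ) + 1) := fun n =>
    (hgt.and (hG0.eventually (gt_mem_nhds (lt_add_of_pos_right _ Nat.one_div_pos_of_nat)))).exists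
  choose y hyb hyG using hseq
  by_cases hcoi : ∀ z : K, ⊥ < z → ∃ n, y n < z
  · classical
    have hH1 : H ⊤ = 0 := (hH ⊤ hbt).unique le_rfl (hasIntegralOn_self f G ⊤)
    let lev : K → ℕ := fun t => if h : ∃ n, y n < t then Nat.find h else 0
    have hlev : ∀ t, ⊥ < t → y (lev t) < t := fun t ht => by
      simp only [lev, dif_pos (hcoi t ht)]
      exact Nat.find_spec (hcoi t ht)
    intro ε hε
    obtain ⟨δ, hδ, h⟩ := exists_uniform_gauge (J := Set.Ioi (⊥ : K)) Set.ordConnected_Ioi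
      (f := f) (G := G) (F := fun x => - H x) (a := y) (b := fun _ => ⊤) (lev := lev)
      (V := fun t => {w | ⊥ < t → y (lev t) < w})
      hyb (fun n => hbt) (fun n => le_top)
      (fun n => by rw [hH1, neg_zero, zero_sub, neg_neg]; exact hH _ (hyb n))
      (fun v hv w hw hvw => by
        rw [neg_sub_neg]
        exact (hH v hv).hasFineSumsNear_left hvw le_top (hH w hw))
      (fun t => by
        by_cases ht : ⊥ < t
        · filter_upwards [lt_mem_nhds (hlev t ht)] with w hw _ using hw
        · exact Eventually.of_forall fun w hw => absurd hw ht)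
      (fun t ht v w hvw _ _ hs => ⟨not_lt.1 fun hlt => by
        -- Otherwise `y (lev t)` would lie in `(v, w]`, and so would be larger than itself.
        exact absurd (hs ⟨hlt, (hs ⟨hvw, le_rfl⟩ ht).le⟩ ht) (lt_irrefl _), le_top⟩)
      (fun u hu v hv => by
        obtain ⟨N, hN⟩ := hcoi u hu
        refine ⟨N + 1, fun t ht => Nat.lt_succ_of_le ?_⟩
        have hex : ∃ n, y n < t := ⟨N, hN.trans_le ht.1⟩
        simp only [lev, dif_pos hex]
        exact Nat.find_min' hex (hN.trans_le ht.1)) (show 0 < ε / 3 by linarith)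
    obtain ⟨z, hz, hzB⟩ := (mem_nhdsGT_iff_exists_Ioo_subset' hbt).1
      (Metric.tendsto_nhds.1 hB (ε / 3) (by linarith))
    choose! a ha using hdense
    let γ : K → Set K := fun x => {w | w ∈ δ x ∧ (⊥ < x → a x < w) ∧
      (x = ⊥ → w < z ∧ |f ⊥ * (G w - G ⊥)| < ε / 3)}
    refine ⟨γ, fun x => ?_, fun s hs => ?_⟩
    · have h1 : ∀ᶠ w in 𝓝 x, ⊥ < x → a x < w := by
        by_cases hx : ⊥ < x
        · filter_upwards [lt_mem_nhds (ha x hx).2] with w hw _ using hw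
        · exact Eventually.of_forall fun w hw => absurd hw hx
      have h2 : ∀ᶠ w in 𝓝 x, x = ⊥ → w < z ∧ |f ⊥ * (G w - G ⊥)| < ε / 3 := by
        by_cases hx : x = ⊥
        · subst hx
          filter_upwards [gt_mem_nhds hz, eventually_mul_sub_lt (hGr ⊥) (f ⊥)
            (show 0 < ε / 3 by linarith)] with w h1 h2 _ using ⟨h1, h2 bot_le⟩
        · exact Eventually.of_forall fun w hw => absurd hw hx
      filter_upwards [hδ x, h1, h2] with w a1 a2 a3 using ⟨a1, a2, a3⟩
    have key : ∀ v s, IsFineSum γ (stieltjesWeight f G) ⊥ v s → ⊥ < v →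
        ∃ x s', ⊥ < x ∧ x < z ∧ |f ⊥ * (G x - G ⊥)| < ε / 3 ∧
          IsFineSum γ (stieltjesWeight f G) x v s' ∧ s = f ⊥ * (G x - G ⊥) + s' := by
      intro v s hv
      induction hv with
      | refl => exact fun hb => absurd hb (lt_irrefl _)
      | @step v s t w hv h1 h2 h3 ih =>
        intro hw
        rcases eq_bot_or_bot_lt v with rfl | hvb
        -- A tag `t > 0_K` is impossible, as `a t` lies in `(0_K, w]` but not in `γ t`.
        · have ht : t = ⊥ := by
            by_contra htb
            have ht : ⊥ < t := bot_lt_iff_ne_bot.2 htb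
            exact absurd ((h3 ⟨(ha t ht).1, ((ha t ht).2.le.trans h2)⟩).2.1 ht) (lt_irrefl _)
          subst ht
          obtain ⟨hwz, hwG⟩ := (h3 ⟨hw, le_rfl⟩).2.2 rfl
          refine ⟨w, 0, hw, hwz, hwG, .refl, ?_⟩
          rw [hv.eq_zero (stieltjesWeight_self f G) rfl, stieltjesWeight]
          ring
        · obtain ⟨x, s', hx, hxz, hxG, hs', rfl⟩ := ih hvb
          exact ⟨x, _, hx, hxz, hxG, hs'.step t w h1 h2 h3, add_assoc _ _ _⟩
    obtain ⟨x, s', hx, hxz, hxG, hs', rfl⟩ := key ⊤ s hs hbt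
    have h3 := abs_lt.1 (h x hx ⊤ hbt s' (hs'.mono fun x w hw => hw.1))
    have h4 : |H x - B| < ε / 3 := hzB ⟨hx, hxz⟩
    have h5 := abs_lt.1 h4
    have h6 := abs_lt.1 hxG
    rw [hH1] at h3
    rw [abs_lt]
    constructor <;> linarith
  · push Not at hcoi
    obtain ⟨c, hc, hcy⟩ := hcoi
    have hLc : G c ≤ G ⊥ := by
      have h0 : Tendsto (fun n : ℕ => G ⊥ + 1 / ((n : ℝ) + 1)) atTop (𝓝 (G ⊥ + 0)) :=
        tendsto_one_div_add_atTop_nhds_zero_nat.const_add _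
      rw [add_zero] at h0
      exact ge_of_tendsto' h0 fun n => (hG (hcy n)).trans (hyG n).le
    have hGc : ∀ x, x ≤ c → G x = G c := fun x hx =>
      le_antisymm (hG hx) (hLc.trans (hG bot_le))
    have hHc : ∀ x, ⊥ < x → x ≤ c → H x = H c := fun x hx hxc =>
      (hH x hx).unique le_top ((hH c hc).extend_left_of_const hxc le_top fun p _ hp => hGc p hp)
    have hev : H =ᶠ[𝓝[>] (⊥ : K)] fun _ => H c := by
      filter_upwards [Ioo_mem_nhdsGT hc] with x hx using hHc x hx.1 hx.2.le
    rw [tendsto_nhds_unique hB (tendsto_const_nhds.congr' hev.symm)]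
    exact (hH c hc).extend_left_of_const bot_le le_top fun p _ hp => hGc p hp

/-! ### Integrals of cut-off functions -/

/-- The integral over the compact line `[0_K, y]` is the integral over `K` of the cut-off
function. -/
theorem hasGIntegral_indicator_Iic [BoundedOrder K] [OrderTopology K] {f G : K → ℝ}
    (hGr : ∀ x : K, ContinuousWithinAt G (Set.Ici x) x) {y : K} {I : ℝ}
    (hI : HasGIntegral ((Set.Iic y).domRestrict f) ((Set.Iic y).domRestrict G) I) :
    HasGIntegral ((Set.Iic y).indicator f) G I := by
  have key : HasIntegralOn ((Set.Iic y).indicator f) G ⊥ ⊤ (I - f ⊥ * G ⊥) := fun ε hε => by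
    obtain ⟨δ, hδ, h⟩ := (hasIntegralOn_of_domRestrict hI).exists_extend_right bot_le (hGr y)
      (g := (Set.Iic y).indicator f) (fun x hx => Set.indicator_of_mem (Set.mem_Iic.2 hx) f)
      hε
    refine ⟨δ, hδ, h ⊤ le_top fun t v w ht _ _ _ => ?_⟩
    rw [Set.indicator_of_notMem (Set.notMem_Iic.2 ht), zero_mul]
  have := hasGIntegral_of_hasIntegralOn key
  rwa [Set.indicator_of_mem (Set.mem_Iic.2 bot_le), sub_add_cancel] at this

theorem hasIntegralOn_of_indicator_Ioi [BoundedOrder K] [OrderTopology K] [CompactSpace K]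
    {f G : K → ℝ} (hGr : ∀ x : K, ContinuousWithinAt G (Set.Ici x) x) {y : K} {I : ℝ}
    (hI : HasGIntegral ((Set.Ioi y).indicator f) G I) : HasIntegralOn f G y ⊤ I := by
  have h := hI.hasIntegralOn
  rw [Set.indicator_of_notMem (Set.notMem_Ioi.2 bot_le), zero_mul, sub_zero] at h
  exact h.of_cutoff_left bot_le (hGr y)
    (fun x hx => Set.indicator_of_notMem (Set.notMem_Ioi.2 hx) f)
    (fun x hx => Set.indicator_of_mem (Set.mem_Ioi.2 hx) f)

theorem LeftDense.nhdsLT_neBot [BoundedOrder K] [OrderTopology K] (h : LeftDense (⊤ : K)) :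
    (𝓝[<] (⊤ : K)).NeBot := by
  refine ⟨fun h' => ?_⟩
  rcases nhdsLT_eq_bot_iff.1 h' with h' | h'
  · exact (h' ⊥).not_gt h.1
  · exact h.2 h'

/-- For monotone `G` and left-dense `1_K`, the limit that defines `L_G(1_K)` exists. -/
theorem tendsto_leftValue_top [BoundedOrder K] [OrderTopology K] {G : K → ℝ} (hG : Monotone G)
    (h : LeftDense (⊤ : K)) : Tendsto G (𝓝[<] (⊤ : K)) (𝓝 (leftValue G ⊤)) := by
  have := h.nhdsLT_neBot
  rw [leftValue, if_neg h.1.ne', dif_neg h.2]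
  exact tendsto_nhds_limUnder ⟨_, hG.tendsto_nhdsLT ⊤⟩

end CompactLine

/-- Here `⊥ = 0_K`, `⊤ = 1_K`, `Set.Iic y = [0_K, y]`, which is itself a compact line, and
`Set.Ioi y = (y, 1_K]`. -/
theorem theorem1p3 {K : Type*} [LinearOrder K] [BoundedOrder K] [Nontrivial K]
    [TopologicalSpace K] [OrderTopology K] [CompactSpace K]
    (G f : K → ℝ) (hG : Monotone G)
    (hGright : ∀ x : K, ContinuousWithinAt G (Set.Ici x) x) :
    (CompactLine.LeftDense (⊤ : K) → ∀ A : ℝ,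
      (∀ y ∈ Set.Ioo (⊥ : K) ⊤,
        CompactLine.GIntegrable ((Set.Iic y).domRestrict f) ((Set.Iic y).domRestrict G)) →
      Tendsto (fun y : K => CompactLine.gIntegral ((Set.Iic y).indicator f) G)
        (𝓝[<] (⊤ : K)) (𝓝 A) →
      (∀ y ∈ Set.Ioo (⊥ : K) ⊤,
        CompactLine.GIntegrable ((Set.Iic y).indicator f) G ∧
        CompactLine.gIntegral ((Set.Iic y).indicator f) G =
          CompactLine.gIntegral ((Set.Iic y).domRestrict f) ((Set.Iic y).domRestrict G)) ∧
      CompactLine.GIntegrable f G ∧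
      CompactLine.gIntegral f G = A + f ⊤ * (G ⊤ - CompactLine.leftValue G ⊤)) ∧
    (CompactLine.RightDense (⊥ : K) → ∀ B : ℝ,
      (∀ y ∈ Set.Ioo (⊥ : K) ⊤, CompactLine.GIntegrable ((Set.Ioi y).indicator f) G) →
      Tendsto (fun y : K => CompactLine.gIntegral ((Set.Ioi y).indicator f) G)
        (𝓝[>] (⊥ : K)) (𝓝 B) →
      CompactLine.GIntegrable f G ∧
      CompactLine.gIntegral f G = B + f ⊥ * G ⊥) := by
  open CompactLine in
  refine ⟨fun hd A hint hA => ?_, fun hd B hint hB => ?_⟩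
  · have hne := hd.nhdsLT_neBot
    have hcut : ∀ y ∈ Set.Ioo (⊥ : K) ⊤, HasGIntegral ((Set.Iic y).indicator f) G
        (gIntegral ((Set.Iic y).domRestrict f) ((Set.Iic y).domRestrict G)) := fun y hy =>
      hasGIntegral_indicator_Iic hGright (hint y hy).hasGIntegral
    refine ⟨fun y hy => ⟨⟨_, hcut y hy⟩, (hcut y hy).gIntegral_eq⟩, ?_⟩
    -- Integrability is assumed only for `y > 0_K`; the primitive over `(0_K, 0_K]` is `0`.
    let F : K → ℝ := fun y =>
      if y = ⊥ then 0 else gIntegral ((Set.Iic y).indicator f) G - f ⊥ * G ⊥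
    have hF : ∀ y < ⊤, HasIntegralOn f G ⊥ y (F y) := by
      intro y hy
      by_cases hyb : y = ⊥
      · subst hyb
        simpa [F] using hasIntegralOn_self f G (⊥ : K)
      · have hy' : y ∈ Set.Ioo (⊥ : K) ⊤ := ⟨bot_lt_iff_ne_bot.2 hyb, hy⟩
        simp only [F, if_neg hyb, (hcut y hy').gIntegral_eq]
        exact hasIntegralOn_of_domRestrict (hint y hy').hasGIntegral
    have hFA : Tendsto F (𝓝[<] (⊤ : K)) (𝓝 (A - f ⊥ * G ⊥)) := by
      refine (hA.sub_const (f ⊥ * G ⊥)).congr' ?_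
      filter_upwards [Ioo_mem_nhdsLT hd.1] with y hy
      simp [F, hy.1.ne']
    have hI := hasGIntegral_of_hasIntegralOn (hasIntegralOn_top_of_tendsto hG hGright
      (tendsto_leftValue_top hG hd) hF hFA)
    refine ⟨⟨_, hI⟩, hI.gIntegral_eq.trans ?_⟩
    ring
  · -- Likewise `(1_K, 1_K]` is not covered by the hypothesis, and its integral is `0`.
    let H : K → ℝ := fun y => if y = ⊤ then 0 else gIntegral ((Set.Ioi y).indicator f) G
    have hH : ∀ y, ⊥ < y → HasIntegralOn f G y ⊤ (H y) := by
      intro y hy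
      by_cases hyt : y = ⊤
      · subst hyt
        simpa [H] using hasIntegralOn_self f G (⊤ : K)
      · simp only [H, if_neg hyt]
        exact hasIntegralOn_of_indicator_Ioi hGright
          (hint y ⟨hy, lt_top_iff_ne_top.2 hyt⟩).hasGIntegral
    have hHB : Tendsto H (𝓝[>] (⊥ : K)) (𝓝 B) := by
      refine hB.congr' ?_
      filter_upwards [Ioo_mem_nhdsGT hd.1] with y hy
      simp [H, hy.2.ne]
    have hI := hasGIntegral_of_hasIntegralOn (hasIntegralOn_bot_of_tendsto hG hGright hd hH hHB)
    exact ⟨⟨_, hI⟩, hI.gIntegral_eq⟩
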